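/- \textbf{Proposition.} Let $1\le\alpha<W$ be integers and let $w=(w[0],\dots,w[W-1])\in\mathbb{C}^W$ be a vector all of whose entries are non-zero. Let $Z\subset\mathbb{C}^W\times\mathbb{C}^W$ be the linear subspace of all pairs $(y_0,y_\alpha)$ such that $$w[j+\alpha]\,y_0[j]=w[j]\,y_\alpha[j+\alpha],\qquad j=0,\dots,W-1-\alpha .$$ For $y\in\mathbb{C}^W$ let $A_y(\omega)=\bigl|\sum_{n=0}^{W-1}y[n]\omega^n\bigr|^2$, for $\omega$ in the unit circle $S^1$, be its Fourier intensity function. Then a generic pair $(y_0,y_\alpha)\in Z$ is determined, up to a global phase, by $A_{y_0}$ and $A_{y_\alpha}$. Precisely: there is a real polynomial in the real and imaginary parts of the entries of a pair, not vanishing identically on $Z$, such that for every $(y_0,y_\alpha)\in Z$ at which it does not vanish the following holds: if $(y'_0,y'_\alpha)\in Z$ satisfies $A_{y_0}=A_{y'_0}$ and $A_{y_\alpha}=A_{y'_\alpha}$, then $(y'_0,y'_\alpha)=e^{\iota\theta}(y_0,y_\alpha)$ for some $\theta\in\mathbb{R}$. -/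

import Mathlib

namespace PhaselessSTFT

noncomputable section

/-- The Fourier transform of `y ∈ ℂ^W` as a function on the unit circle:
`ŷ(ω) = y[0] + y[1] ω + ⋯ + y[W-1] ω^(W-1)`. -/
def fourier {W : ℕ} (y : Fin W → ℂ) (ω : Circle) : ℂ :=
  ∑ n : Fin W, y n * (ω : ℂ) ^ (n : ℕ)

/-- The Fourier intensity function `A_y(ω) = |ŷ(ω)|²` on the unit circle. -/
def fourierIntensity {W : ℕ} (y : Fin W → ℂ) : Circle → ℝ :=
  fun ω => ‖fourier y ω‖ ^ 2

/-- The linear subspace of `ℂ^W × ℂ^W` of the pairs `(y₀, y_α)` with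
`w[j+α] y₀[j] = w[j] y_α[j+α]` for `j = 0, …, W-1-α`. -/
def linearRelations {W : ℕ} (α : ℕ) (w : Fin W → ℂ) :
    Submodule ℂ ((Fin W → ℂ) × (Fin W → ℂ)) where
  carrier := {y | ∀ (j : ℕ) (h : j + α < W),
    w ⟨j + α, h⟩ * y.1 ⟨j, by omega⟩ = w ⟨j, by omega⟩ * y.2 ⟨j + α, h⟩}
  zero_mem' := by
    intro j h
    simp
  add_mem' := by
    intro a b ha hb j h
    have h1 := ha j h
    have h2 := hb j h
    simp only [Prod.fst_add, Prod.snd_add, Pi.add_apply, mul_add, h1, h2]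
  smul_mem' := by
    intro c a ha j h
    have h1 := ha j h
    simp only [Prod.smul_fst, Prod.smul_snd, Pi.smul_apply, smul_eq_mul]
    linear_combination c * h1

/-- The `4W` real coordinates of a pair of vectors in `ℂ^W`: the real parts of all entries,
then the imaginary parts of all entries. -/
def realCoords {W : ℕ} (y : (Fin W → ℂ) × (Fin W → ℂ)) :
    (Fin W ⊕ Fin W) ⊕ (Fin W ⊕ Fin W) → ℝ :=
  Sum.elim (fun i => (Sum.elim y.1 y.2 i).re) (fun i => (Sum.elim y.1 y.2 i).im)

/-- `P` holds for a generic element of the linear subspace `Z`: the elements of `Z` for which `P`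
fails all lie in the zero set of a real polynomial in the real and imaginary parts of the
entries that does not vanish identically on `Z`. -/
def GenericOn {W : ℕ} (Z : Submodule ℂ ((Fin W → ℂ) × (Fin W → ℂ)))
    (P : (Fin W → ℂ) × (Fin W → ℂ) → Prop) : Prop :=
  ∃ p : MvPolynomial ((Fin W ⊕ Fin W) ⊕ (Fin W ⊕ Fin W)) ℝ,
    (∃ z ∈ Z, MvPolynomial.eval (realCoords z) p ≠ 0) ∧
    ∀ z ∈ Z, MvPolynomial.eval (realCoords z) p ≠ 0 → P z

end

end PhaselessSTFT

/-! Put N = W - 1. On the circle, ω^N A_y(ω) is the product of the polynomial of y and that of its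
reversed conjugate, so equal intensities mean two factorizations of one polynomial. With the
conjugate entries treated as independent variables, a pair in Z becomes two products P₀Q₀ and P₁Q₁,
with linear relations between P₀ and P₁ and between Q₀ and Q₁.

The argument spreads out from one point of this complexification: P₀ = 1, Q₀ = X^N, P₁ = r₀(X-1)^α,
Q₁ = κX^(N-α)(X-2)^α. There the relations determine the factors up to scalars
(`factors_eq_of_relations`).

Suppose the set B of bad pairs lies in no proper zero set. Then a polynomial that is non-zero at the
base point is non-zero somewhere on B. Hence there are a homomorphism ψ from the functions on B to a
field K and a valuation ring of K through which ψ specializes to the base point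
(`exists_valuationSubring_specialization`). A counterexample chosen for each bad pair gives, through
ψ, a second pair of factorizations over K. Gauss's lemma makes them integral up to scalars, the base
point determines their reductions, and coprimality makes the lifts unique: both pairs agree up to
one scalar (`exists_common_scalar`). So all minors of pair and counterexample die under ψ, hence
vanish together at an actual bad pair (`exists_minors_eq_zero`). There the two are proportional, and
equal intensities leave only a phase: a contradiction. -/

namespace PhaselessSTFT

open Polynomial IsLocalRing

/-! ### Factorization of polynomials over a valuation ring. -/

section ValuationRing

variable {V K : Type*} [CommRing V] [IsDomain V] [ValuationRing V] [Field K] [Algebra V K]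
  [IsFractionRing V K]

/-- A non-zero polynomial over the fraction field of a valuation ring is a scalar multiple of a
polynomial over the valuation ring whose reduction is non-zero. -/
theorem exists_eq_C_mul_map_of_ne_zero {G : K[X]} (hG : G ≠ 0) :
    ∃ (c : K) (g : V[X]), c ≠ 0 ∧ G = C c * g.map (algebraMap V K) ∧
      g.map (residue V) ≠ 0 := by
  -- Dividing by a coefficient of largest valuation makes every coefficient integral and one of them
  -- 1.
  obtain ⟨i, hi, hmax⟩ := G.support.exists_max_image
    (fun n => ValuationRing.valuation V K (G.coeff n)) (support_nonempty.2 hG)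
  have hc : G.coeff i ≠ 0 := mem_support_iff.1 hi
  have hlift : C (G.coeff i)⁻¹ * G ∈ lifts (algebraMap V K) := by
    rw [lifts_iff_coeff_lifts]
    intro n
    rw [coeff_C_mul]
    refine (ValuationRing.mem_integer_iff V K _).1 ?_
    rw [Valuation.mem_integer_iff, map_mul, map_inv₀]
    have hpos : 0 < ValuationRing.valuation V K (G.coeff i) :=
      zero_lt_iff.2 ((Valuation.ne_zero_iff _).2 hc)
    rw [inv_mul_le_iff₀ hpos, mul_one]
    by_cases hn : n ∈ G.support
    · exact hmax n hn
    · rw [notMem_support_iff.1 hn, map_zero]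
      exact zero_le
  obtain ⟨g, hg⟩ := (mem_lifts _).1 hlift
  refine ⟨G.coeff i, g, hc, ?_, ?_⟩
  · rw [hg, ← mul_assoc, ← C_mul, mul_inv_cancel₀ hc, C_1, one_mul]
  · intro h0
    have h1 : algebraMap V K (g.coeff i) = algebraMap V K 1 := by
      rw [← coeff_map, hg, coeff_C_mul, inv_mul_cancel₀ hc, map_one]
    have h2 := congrArg (fun p => coeff p i) h0
    simp only [coeff_map, IsFractionRing.injective V K h1, map_one, coeff_zero] at h2
    exact one_ne_zero h2

/-- Gauss's lemma for a valuation ring: a factorization over the fraction field of a polynomial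
with non-zero reduction comes, up to a scalar, from a factorization over the ring. -/
theorem exists_factorization_of_map_eq_mul {f : V[X]} (hf : f.map (residue V) ≠ 0) {G H : K[X]}
    (h : G * H = f.map (algebraMap V K)) :
    ∃ (c : K) (g q : V[X]), c ≠ 0 ∧ G = C c * g.map (algebraMap V K) ∧
      H = C c⁻¹ * q.map (algebraMap V K) ∧ g * q = f := by
  have hinj : Function.Injective (algebraMap V K) := IsFractionRing.injective V K
  have hf0 : f.map (algebraMap V K) ≠ 0 := by
    intro h0
    rw [Polynomial.map_eq_zero_iff hinj] at h0
    simp [h0] at hf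
  obtain ⟨c, g, hc, hg, hg0⟩ :=
    exists_eq_C_mul_map_of_ne_zero (V := V) (left_ne_zero_of_mul (h ▸ hf0))
  obtain ⟨d, q, hd, hq, hq0⟩ :=
    exists_eq_C_mul_map_of_ne_zero (V := V) (right_ne_zero_of_mul (h ▸ hf0))
  have hprod : C (c * d) * (g * q).map (algebraMap V K) = f.map (algebraMap V K) := by
    rw [← h, hg, hq, Polynomial.map_mul, C_mul]
    ring
  have hcd : c * d ≠ 0 := mul_ne_zero hc hd
  have hgq0 : (g * q).map (residue V) ≠ 0 := by
    rw [Polynomial.map_mul]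
    exact mul_ne_zero hg0 hq0
  obtain ⟨u, hu⟩ : ∃ u : V, algebraMap V K u = c * d := by
    -- If only the inverse v of c d is integral, then g q = v f still has non-zero reduction, so v
    -- is a unit.
    rcases ValuationRing.isInteger_or_isInteger V (c * d) with hu | ⟨v, hv⟩
    · exact hu
    · have h1 : g * q = C v * f := by
        apply Polynomial.map_injective _ hinj
        rw [Polynomial.map_mul (p := C v), map_C, hv, ← hprod, ← mul_assoc, ← C_mul,
          inv_mul_cancel₀ hcd, C_1, one_mul]
      have hv0 : residue V v ≠ 0 := by
        intro h0
        rw [h1, Polynomial.map_mul, map_C, h0, C_0, zero_mul] at hgq0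
        exact hgq0 rfl
      obtain ⟨v', rfl⟩ := (residue_ne_zero_iff_isUnit v).1 hv0
      refine ⟨(v'⁻¹ : Vˣ), ?_⟩
      have h2 : algebraMap V K (v'⁻¹ : Vˣ) * algebraMap V K v' = 1 := by
        rw [← map_mul, Units.inv_mul, map_one]
      rw [hv] at h2
      field_simp at h2
      exact h2
  refine ⟨c, g, C u * q, hc, hg, ?_, ?_⟩
  · rw [Polynomial.map_mul, map_C, hu, ← mul_assoc, ← C_mul, hq]
    congr 2
    field_simp
  · apply Polynomial.map_injective _ hinj
    rw [← hprod, ← hu, Polynomial.map_mul, Polynomial.map_mul, Polynomial.map_mul, map_C]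
    ring

/-- If `p q = P Q`, if the reductions of `P` and `q` are coprime, and if the degree of `q` does
not drop under reduction and is at least that of `Q`, then `p` is proportional to `P`. -/
theorem exists_map_eq_C_mul_map_of_isCoprime {P Q p q : V[X]} {N : ℕ} (h : p * q = P * Q)
    (hQ : Q.natDegree ≤ N) (hq : q.natDegree ≤ N) (hqN : (q.map (residue V)).natDegree = N)
    (hq0 : q.map (residue V) ≠ 0) (hP0 : P.map (residue V) ≠ 0)
    (hcop : IsCoprime (P.map (residue V)) (q.map (residue V))) :
    ∃ γ : K, p.map (algebraMap V K) = C γ * P.map (algebraMap V K) := by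
  have hinj : Function.Injective (algebraMap V K) := IsFractionRing.injective V K
  have hqne : q.map (algebraMap V K) ≠ 0 := by
    intro h0
    rw [Polynomial.map_eq_zero_iff hinj] at h0
    simp [h0] at hq0
  have hPne : P.map (algebraMap V K) ≠ 0 := by
    intro h0
    rw [Polynomial.map_eq_zero_iff hinj] at h0
    simp [h0] at hP0
  have hdegq : q.natDegree = N := le_antisymm hq (hqN ▸ natDegree_map_le)
  have hcopK : IsCoprime (P.map (algebraMap V K)) (q.map (algebraMap V K)) := by
    -- A common irreducible factor comes from a divisor g of q over V. Since the degree of q does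
    -- not drop, neither does that of g; but the reduction of g divides two coprime polynomials.
    refine isCoprime_of_irreducible_dvd (fun h0 => hPne h0.1) ?_
    rintro z hz ⟨x, hx⟩ ⟨y, hy⟩
    obtain ⟨c, g, t, hc, hg, -, hgt⟩ := exists_factorization_of_map_eq_mul hq0 hy.symm
    have hgt0 : g.map (residue V) * t.map (residue V) = q.map (residue V) := by
      rw [← Polynomial.map_mul, hgt]
    have hg0 : g.map (residue V) ≠ 0 := left_ne_zero_of_mul (hgt0 ▸ hq0)
    have ht0 : t.map (residue V) ≠ 0 := right_ne_zero_of_mul (hgt0 ▸ hq0)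
    have hdeg : (g.map (residue V)).natDegree = g.natDegree := by
      have h1 : g.natDegree + t.natDegree = N := by
        rw [← natDegree_mul, hgt, hdegq]
        · rintro rfl; simp at hg0
        · rintro rfl; simp at ht0
      have h2 : (g.map (residue V)).natDegree + (t.map (residue V)).natDegree = N := by
        rw [← natDegree_mul hg0 ht0, hgt0, hqN]
      have h3 : (g.map (residue V)).natDegree ≤ g.natDegree := natDegree_map_le
      have h4 : (t.map (residue V)).natDegree ≤ t.natDegree := natDegree_map_le
      omega
    have hgP : g.map (algebraMap V K) * (C c * x) = P.map (algebraMap V K) := by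
      rw [hx, hg]; ring
    obtain ⟨d, g', t', hd, hg', -, hgt'⟩ := exists_factorization_of_map_eq_mul hP0 hgP
    have hg'P : g'.map (residue V) ∣ P.map (residue V) := ⟨t'.map (residue V), by
      rw [← Polynomial.map_mul, hgt']⟩
    -- Here g = d g' over K; either d or its inverse is integral, and both cases give divisibility
    -- after reduction.
    have hdu : ∃ u : V, algebraMap V K u = d ∨ algebraMap V K u = d⁻¹ := by
      rcases ValuationRing.isInteger_or_isInteger V d with ⟨u, hu⟩ | ⟨u, hu⟩
      · exact ⟨u, Or.inl hu⟩
      · exact ⟨u, Or.inr hu⟩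
    have hg'0 : g'.map (residue V) ≠ 0 := by
      intro h0
      rw [h0, zero_dvd_iff] at hg'P
      exact hP0 hg'P
    have hdvd : g.map (residue V) ∣ P.map (residue V) := by
      obtain ⟨u, hu | hu⟩ := hdu
      · have h1 : g = C u * g' := by
          apply Polynomial.map_injective _ hinj
          rw [hg', Polynomial.map_mul, map_C, hu]
        have h2 : residue V u ≠ 0 := by
          intro h0
          rw [h1, Polynomial.map_mul, map_C, h0, C_0, zero_mul] at hg0
          exact hg0 rfl
        rw [h1, Polynomial.map_mul, map_C]
        exact (IsUnit.mul_left_dvd (isUnit_C.2 (isUnit_iff_ne_zero.2 h2))).2 hg'P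
      · have h1 : g' = C u * g := by
          apply Polynomial.map_injective _ hinj
          rw [Polynomial.map_mul, map_C, hu, hg', ← mul_assoc, ← C_mul, inv_mul_cancel₀ hd, C_1,
            one_mul]
        rw [h1, Polynomial.map_mul] at hg'P
        exact (dvd_mul_left _ _).trans hg'P
    have hunit := hcop.isUnit_of_dvd' hdvd ⟨_, hgt0.symm⟩
    have hz0 : z.natDegree = 0 := by
      rw [hg, natDegree_C_mul hc, natDegree_map_eq_of_injective hinj, ← hdeg]
      exact natDegree_eq_zero_of_isUnit hunit
    exact hz.natDegree_pos.ne' hz0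
  have hmul : p.map (algebraMap V K) * q.map (algebraMap V K)
      = P.map (algebraMap V K) * Q.map (algebraMap V K) := by
    rw [← Polynomial.map_mul, h, Polynomial.map_mul]
  obtain ⟨x, hx⟩ : P.map (algebraMap V K) ∣ p.map (algebraMap V K) :=
    hcopK.dvd_of_dvd_mul_right ⟨_, hmul⟩
  have hQx : Q.map (algebraMap V K) = x * q.map (algebraMap V K) := by
    apply mul_left_cancel₀ hPne
    rw [← hmul, hx]; ring
  by_cases hx0 : x = 0
  · exact ⟨0, by rw [hx, hx0]; simp⟩
  · have h1 : (Q.map (algebraMap V K)).natDegree = x.natDegree + N := by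
      rw [hQx, natDegree_mul hx0 hqne, natDegree_map_eq_of_injective hinj, hdegq]
    rw [natDegree_map_eq_of_injective hinj] at h1
    have h2 : x.natDegree = 0 := by omega
    refine ⟨x.coeff 0, ?_⟩
    rw [hx, eq_C_of_natDegree_eq_zero h2]
    simp [mul_comm]

end ValuationRing

end PhaselessSTFT

namespace PhaselessSTFT

open Polynomial

/-! ### Rigidity of the base point. -/

section Field

variable {k : Type*} [Field k]

theorem exists_eq_C_mul_pow_of_dvd_pow {a : k} {d : k[X]} {n : ℕ} (h : d ∣ (X - C a) ^ n) :
    ∃ (c : k) (m : ℕ), c ≠ 0 ∧ d = C c * (X - C a) ^ m := by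
  obtain ⟨m, -, u, hu⟩ := (dvd_prime_pow (prime_X_sub_C a) n).1 h
  obtain ⟨c, hc, hcu⟩ := isUnit_iff.1 (u⁻¹).isUnit
  refine ⟨c, m, hc.ne_zero, ?_⟩
  rw [hcu, ← hu, mul_comm, mul_assoc, Units.mul_inv, mul_one]

theorem exists_eq_C_mul_X_pow_of_mul_eq {p q : k[X]} {N : ℕ} (h : p * q = X ^ N) :
    ∃ (c : k) (i : ℕ), c ≠ 0 ∧ i ≤ N ∧ p = C c * X ^ i ∧ q = C c⁻¹ * X ^ (N - i) := by
  have hX : (X : k[X]) ^ N ≠ 0 := pow_ne_zero _ X_ne_zero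
  have hd : p ∣ (X - C (0 : k)) ^ N := by simpa using ⟨q, h.symm⟩
  obtain ⟨c, i, hc, hp⟩ := exists_eq_C_mul_pow_of_dvd_pow hd
  rw [C_0, sub_zero] at hp
  have hi : i ≤ N := by
    have := natDegree_le_of_dvd ⟨q, h.symm⟩ hX
    rwa [hp, natDegree_C_mul_X_pow _ _ hc, natDegree_X_pow] at this
  refine ⟨c, i, hc, hi, hp, ?_⟩
  have hp0 : p ≠ 0 := left_ne_zero_of_mul (h ▸ hX)
  apply mul_left_cancel₀ hp0
  rw [h, hp]
  have h1 : (C c * C c⁻¹ : k[X]) = 1 := by rw [← C_mul, mul_inv_cancel₀ hc, C_1]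
  calc (X : k[X]) ^ N = X ^ i * X ^ (N - i) := by rw [← pow_add, Nat.add_sub_cancel' hi]
    _ = (C c * C c⁻¹) * (X ^ i * X ^ (N - i)) := by rw [h1, one_mul]
    _ = _ := by ring

/-- Minus the sum of the roots with multiplicity. For the roots 1 and 2 in characteristic zero it is
non-zero unless m = n = 0. -/
theorem nextCoeff_X_sub_C_pow_mul (a b : k) (m n : ℕ) :
    ((X - C a) ^ m * (X - C b) ^ n).nextCoeff = -(m * a + n * b) := by
  rw [((monic_X_sub_C a).pow m).nextCoeff_mul ((monic_X_sub_C b).pow n),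
    (monic_X_sub_C a).nextCoeff_pow, (monic_X_sub_C b).nextCoeff_pow, nextCoeff_X_sub_C,
    nextCoeff_X_sub_C]
  simp only [nsmul_eq_mul]
  ring

/-- The base point of the specialization argument: here the pair of factorizations is
determined, up to scalars, by the linear relations between its members. -/
theorem factors_eq_of_relations [CharZero k] {N α : ℕ} (hα : 1 ≤ α) (hαN : α ≤ N) {r s : ℕ → k}
    (hr : ∀ j, r j ≠ 0) (hs : ∀ j, s j ≠ 0) {κ : k} (hκ : κ * (-2) ^ α = s 0)
    {p₀ q₀ p₁ q₁ : k[X]} (hp₁N : p₁.natDegree ≤ N) (hq₁N : q₁.natDegree ≤ N)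
    (h₀ : p₀ * q₀ = X ^ N)
    (h₁ : p₁ * q₁ = (C (r 0) * (X - C 1) ^ α) * (X ^ (N - α) * (C κ * (X - C 2) ^ α)))
    {a b : k} (hab : a ≠ 0 ∨ b ≠ 0)
    (hrel : ∀ j, j + α ≤ N → a * p₁.coeff (j + α) = b * (r j * p₀.coeff j))
    (hrel' : ∀ j, j + α ≤ N → b * q₁.coeff (N - (j + α)) = a * (s j * q₀.coeff (N - j))) :
    (∃ c, c ≠ 0 ∧ p₀ = C c) ∧ ∃ c, c ≠ 0 ∧ p₁ = C c * (X - C 1) ^ α := by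
  have hκ0 : κ ≠ 0 := by
    rintro rfl
    exact hs 0 (by rw [← hκ, zero_mul])
  obtain ⟨c, i, hc, hiN, hp₀, hq₀⟩ := exists_eq_C_mul_X_pow_of_mul_eq h₀
  have hc' := inv_ne_zero hc
  set g : k[X] := (C (r 0) * (X - C 1) ^ α) * (C κ * (X - C 2) ^ α) with hg
  have hg0 : g ≠ 0 := by
    simp only [hg, ne_eq, mul_eq_zero, C_eq_zero, hr, hκ0, pow_eq_zero_iff', X_sub_C_ne_zero,
      false_and, or_self, not_false_eq_true]
  have hgdeg : g.natDegree = 2 * α := by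
    rw [hg, natDegree_mul, natDegree_C_mul (hr 0), natDegree_C_mul hκ0, natDegree_pow,
      natDegree_pow, natDegree_X_sub_C, natDegree_X_sub_C]
    · ring
    · exact left_ne_zero_of_mul hg0
    · exact right_ne_zero_of_mul hg0
  have hgc : g.coeff 0 = (-1) ^ α * (r 0 * s 0) := by
    rw [hg, coeff_zero_eq_eval_zero]
    simp only [eval_mul, eval_pow, eval_sub, eval_X, eval_C, zero_sub]
    rw [← hκ]; ring
  have hgc0 : g.coeff 0 ≠ 0 := by
    rw [hgc]
    exact mul_ne_zero (pow_ne_zero _ (by simp)) (mul_ne_zero (hr 0) (hs 0))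
  have h₁g : p₁ * q₁ = X ^ (N - α) * g := by rw [h₁, hg]; ring
  have hXg0 : X ^ (N - α) * g ≠ 0 := mul_ne_zero (pow_ne_zero _ X_ne_zero) hg0
  have hp₁0 : p₁ ≠ 0 := left_ne_zero_of_mul (h₁g ▸ hXg0)
  have hq₁0 : q₁ ≠ 0 := right_ne_zero_of_mul (h₁g ▸ hXg0)
  have hdeg : p₁.natDegree + q₁.natDegree = N + α := by
    rw [← natDegree_mul hp₁0 hq₁0, h₁g, natDegree_mul (pow_ne_zero _ X_ne_zero) hg0,
      natDegree_X_pow, hgdeg]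
    omega
  have hord : ∀ m, X ^ m ∣ p₁ * q₁ → m ≤ N - α := by
    intro m hm
    by_contra! hlt
    rw [h₁g] at hm
    obtain ⟨t, ht⟩ := (pow_dvd_pow X hlt).trans hm
    rw [pow_succ, mul_assoc] at ht
    have := mul_left_cancel₀ (pow_ne_zero _ X_ne_zero) ht
    rw [this] at hgc0
    simp at hgc0
  have hcoeff₀ : ∀ j, p₀.coeff j = if j = i then c else 0 := by
    intro j; rw [hp₀, coeff_C_mul_X_pow]
  have hcoeff₀' : ∀ j, j ≤ N → q₀.coeff (N - j) = if j = i then c⁻¹ else 0 := by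
    intro j hj
    rw [hq₀, coeff_C_mul_X_pow]
    congr 1
    simp only [eq_iff_iff]; omega
  -- Otherwise the relations kill either the coefficients of `p₁` from α on, so that the degrees
  -- cannot add up to N + α, or those of `q₁` up to N - α, which gives too high a power of X.
  have hi : i + α ≤ N := by
    by_contra! hlt
    rcases hab with ha | hb
    · have : p₁.natDegree < α := by
        rw [natDegree_lt_iff_degree_lt hp₁0, degree_lt_iff_coeff_zero]
        intro m hm
        rcases le_or_gt m N with hmN | hmN
        · have h1 := hrel (m - α) (by omega)
          rw [hcoeff₀, if_neg (by omega), Nat.sub_add_cancel hm, mul_zero, mul_zero] at h1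
          exact (mul_eq_zero.1 h1).resolve_left ha
        · exact coeff_eq_zero_of_natDegree_lt (lt_of_le_of_lt hp₁N hmN)
      omega
    · have : X ^ (N - α + 1) ∣ q₁ := by
        rw [X_pow_dvd_iff]
        intro m hm
        have h1 := hrel' (N - α - m) (by omega)
        rw [hcoeff₀' _ (by omega), if_neg (by omega), mul_zero, mul_zero,
          show N - (N - α - m + α) = m by omega] at h1
        exact (mul_eq_zero.1 h1).resolve_left hb
      have := hord _ (this.mul_left _)
      omega
  have hreli := hrel i hi
  have hreli' := hrel' i hi
  rw [hcoeff₀, if_pos rfl] at hreli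
  rw [hcoeff₀' _ hiN, if_pos rfl] at hreli'
  have hb : b ≠ 0 := by
    rintro rfl
    rw [zero_mul, eq_comm, mul_eq_zero, or_iff_left (mul_ne_zero (hs i) hc')] at hreli'
    simp [hreli'] at hab
  have ha : a ≠ 0 := by
    rintro rfl
    rw [zero_mul, eq_comm, mul_eq_zero, or_iff_left (mul_ne_zero (hr i) hc)] at hreli
    exact hb hreli
  have hp₁c : ∀ j, j + α ≤ N → j ≠ i → p₁.coeff (j + α) = 0 := by
    intro j hj hji
    have h1 := hrel j hj
    rw [hcoeff₀, if_neg hji, mul_zero, mul_zero] at h1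
    exact (mul_eq_zero.1 h1).resolve_left ha
  have hp₁i : p₁.coeff (i + α) ≠ 0 := by
    intro h0
    rw [h0, mul_zero] at hreli
    exact mul_ne_zero hb (mul_ne_zero (hr i) hc) hreli.symm
  have hp₁deg : p₁.natDegree = i + α := by
    apply le_antisymm _ (le_natDegree_of_ne_zero hp₁i)
    rw [natDegree_le_iff_coeff_eq_zero]
    intro m hm
    rcases le_or_gt m N with hmN | hmN
    · have := hp₁c (m - α) (by omega) (by omega)
      rwa [Nat.sub_add_cancel (by omega)] at this
    · exact coeff_eq_zero_of_natDegree_lt (lt_of_le_of_lt hp₁N hmN)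
  have hq₁dvd : X ^ (N - (i + α)) ∣ q₁ := by
    rw [X_pow_dvd_iff]
    intro m hm
    have h1 := hrel' (N - α - m) (by omega)
    rw [hcoeff₀' _ (by omega), if_neg (by omega), mul_zero, mul_zero,
      show N - (N - α - m + α) = m by omega] at h1
    exact (mul_eq_zero.1 h1).resolve_left hb
  obtain ⟨q', hq'⟩ := hq₁dvd
  have hq'c : q'.coeff 0 = q₁.coeff (N - (i + α)) := by
    rw [hq', coeff_X_pow_mul', if_pos le_rfl, Nat.sub_self]
  have hq'0 : q'.coeff 0 ≠ 0 := by
    rw [hq'c]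
    intro h0
    rw [h0, mul_zero] at hreli'
    exact mul_ne_zero ha (mul_ne_zero (hs i) hc') hreli'.symm
  have h2 : p₁ * q' = X ^ i * g := by
    apply mul_left_cancel₀ (pow_ne_zero (N - (i + α)) (X_ne_zero (R := k)))
    calc X ^ (N - (i + α)) * (p₁ * q') = p₁ * q₁ := by rw [hq']; ring
      _ = X ^ (N - (i + α) + i) * g := by rw [h₁g, show N - (i + α) + i = N - α by omega]
      _ = _ := by rw [pow_add]; ring
  -- The cofactor `q'` has non-zero constant term, so the remaining power of X sits in `p₁`.
  have hXp : X ^ i ∣ p₁ := by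
    refine prime_X.pow_dvd_of_dvd_mul_right i ?_ ⟨g, h2⟩
    rwa [X_dvd_iff]
  obtain ⟨p', hp'⟩ := hXp
  have h3 : p' * q' = g := by
    apply mul_left_cancel₀ (pow_ne_zero i (X_ne_zero (R := k)))
    rw [← h2, hp']; ring
  have hp'g : p' ∣ (X - C 1) ^ α * (X - C 2) ^ α := by
    have h4 : p' ∣ C (r 0 * κ) * ((X - C 1) ^ α * (X - C 2) ^ α) :=
      ⟨q', by rw [h3, hg, C_mul]; ring⟩
    exact (IsUnit.dvd_mul_left
      (isUnit_C.2 (isUnit_iff_ne_zero.2 (mul_ne_zero (hr 0) hκ0)))).1 h4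
  obtain ⟨d₁, d₂, hd₁, hd₂, hd⟩ := exists_dvd_and_dvd_of_dvd_mul hp'g
  obtain ⟨c₁, m, hc₁, hm⟩ := exists_eq_C_mul_pow_of_dvd_pow hd₁
  obtain ⟨c₂, n, hc₂, hn⟩ := exists_eq_C_mul_pow_of_dvd_pow hd₂
  have hC : c₁ * c₂ ≠ 0 := mul_ne_zero hc₁ hc₂
  have hp'eq : p' = C (c₁ * c₂) * ((X - C 1) ^ m * (X - C 2) ^ n) := by
    rw [hd, hm, hn, C_mul]; ring
  have hmonic : ((X - C (1 : k)) ^ m * (X - C 2) ^ n).Monic :=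
    ((monic_X_sub_C _).pow m).mul ((monic_X_sub_C _).pow n)
  have hdegmn : ((X - C (1 : k)) ^ m * (X - C 2) ^ n).natDegree = m + n := by
    rw [((monic_X_sub_C _).pow m).natDegree_mul ((monic_X_sub_C _).pow n), natDegree_pow,
      natDegree_pow, natDegree_X_sub_C, natDegree_X_sub_C, mul_one, mul_one]
  have hp'0 : p' ≠ 0 := by
    rintro rfl
    rw [mul_zero] at hp'
    exact hp₁0 hp'
  have hmn : m + n = α := by
    have h5 : p₁.natDegree = i + (m + n) := by
      rw [hp', natDegree_mul (pow_ne_zero _ X_ne_zero) hp'0, natDegree_X_pow, hp'eq,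
        natDegree_C_mul hC, hdegmn]
    omega
  have hcoeffp : ∀ j, p₁.coeff (j + i)
      = c₁ * c₂ * ((X - C (1 : k)) ^ m * (X - C 2) ^ n).coeff j := by
    intro j
    rw [hp', coeff_X_pow_mul, hp'eq, coeff_C_mul]
  -- For i > 0 the relation at j = i - 1 kills the second-highest coefficient of `p'`, a non-zero
  -- multiple of m + 2n.
  have hi0 : i = 0 := by
    by_contra hi0
    have h6 := hp₁c (i - 1) (by omega) (by omega)
    rw [show i - 1 + α = (α - 1) + i by omega, hcoeffp] at h6
    have h7 := nextCoeff_X_sub_C_pow_mul (1 : k) 2 m n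
    rw [nextCoeff_of_natDegree_pos (by omega), hdegmn, hmn,
      (mul_eq_zero.1 h6).resolve_left hC] at h7
    have h8 : ((m + n * 2 : ℕ) : k) = 0 := by
      push_cast
      linear_combination h7
    rw [Nat.cast_eq_zero] at h8
    omega
  subst hi0
  have hlead : p₁.coeff α = c₁ * c₂ := by
    have h9 := hcoeffp α
    rw [add_zero] at h9
    rw [h9, ← hmn, ← hdegmn, hmonic.coeff_natDegree, mul_one]
  rw [zero_add] at hreli hreli' hq'c
  -- Multiplying the two relations cancels the unknown scalars a, b and c.
  have hprod : p₁.coeff α * q₁.coeff (N - α) = r 0 * s 0 := by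
    apply mul_left_cancel₀ (mul_ne_zero ha hb)
    calc a * b * (p₁.coeff α * q₁.coeff (N - α))
        = (a * p₁.coeff α) * (b * q₁.coeff (N - α)) := by ring
      _ = (c * c⁻¹) * (a * b * (r 0 * s 0)) := by rw [hreli, hreli']; ring
      _ = _ := by rw [mul_inv_cancel₀ hc, one_mul]
  -- Comparing constant terms in p' q' = g leaves 2^n = 1; this excludes the root 2 from `p₁`.
  have hn0 : n = 0 := by
    have h10 : p'.coeff 0 * q'.coeff 0 = (-1) ^ α * (r 0 * s 0) := by
      rw [← mul_coeff_zero, h3, hgc]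
    have h11 : p'.coeff 0 = p₁.coeff α * ((-1) ^ α * 2 ^ n) := by
      rw [hlead, hp'eq, coeff_zero_eq_eval_zero]
      simp only [eval_mul, eval_pow, eval_sub, eval_X, eval_C, zero_sub]
      rw [← hmn, pow_add, neg_pow (2 : k)]; ring
    rw [h11, hq'c] at h10
    have h12 : ((-1) ^ α * (r 0 * s 0)) * (2 : k) ^ n = ((-1) ^ α * (r 0 * s 0)) * 1 := by
      rw [← hprod] at h10 ⊢
      linear_combination h10
    have h13 := mul_left_cancel₀ (hgc ▸ hgc0) h12
    have h14 : (2 : ℕ) ^ n = 1 := by exact_mod_cast h13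
    exact (Nat.pow_eq_one.1 h14).resolve_left (by norm_num)
  subst hn0
  refine ⟨⟨c, hc, by rw [hp₀, pow_zero, mul_one]⟩, c₁ * c₂, hC, ?_⟩
  rw [hp', hp'eq, pow_zero, pow_zero, one_mul, mul_one, ← hmn, add_zero]

end Field

end PhaselessSTFT

namespace PhaselessSTFT

open Polynomial IsLocalRing

/-! ### Lifting rigidity from the residue field to the fraction field. -/

section ValuationRing

variable {V K : Type*} [CommRing V] [IsDomain V] [ValuationRing V] [Field K] [Algebra V K]
  [IsFractionRing V K]

/-- Uniqueness of the lift of a coprime factorization: if `p q = P Q` and the reduction of `p` is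
proportional to that of `P`, then `p` is proportional to `P`. -/
theorem exists_map_eq_C_mul_map_of_map_residue_eq {P Q p q : V[X]} {N : ℕ} (h : p * q = P * Q)
    (hQ : Q.natDegree ≤ N) (hq : q.natDegree ≤ N) (hQN : (Q.map (residue V)).natDegree = N)
    (hQ0 : Q.map (residue V) ≠ 0) (hP0 : P.map (residue V) ≠ 0)
    (hcop : IsCoprime (P.map (residue V)) (Q.map (residue V))) {c : ResidueField V} (hc : c ≠ 0)
    (hp : p.map (residue V) = C c * P.map (residue V)) :
    ∃ γ : K, p.map (algebraMap V K) = C γ * P.map (algebraMap V K) := by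
  have hQq : Q.map (residue V) = C c * q.map (residue V) := by
    apply mul_left_cancel₀ hP0
    rw [← Polynomial.map_mul, ← h, Polynomial.map_mul, hp]
    ring
  have hcu : IsUnit (C c : (ResidueField V)[X]) := isUnit_C.2 (isUnit_iff_ne_zero.2 hc)
  refine exists_map_eq_C_mul_map_of_isCoprime h hQ hq ?_ ?_ hP0 ?_
  · rw [← hQN, hQq, natDegree_C_mul hc]
  · exact right_ne_zero_of_mul (hQq ▸ hQ0)
  · rw [hQq] at hcop
    exact (isCoprime_mul_unit_left_right hcu _ _).1 hcop

theorem isCoprime_X_sub_C_pow {k : Type*} [Field k] {a b : k} (hab : a ≠ b) (m n : ℕ) :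
    IsCoprime ((X - C a) ^ m) ((X - C b) ^ n) :=
  (isCoprime_X_sub_C_of_isUnit_sub (isUnit_iff_ne_zero.2 (sub_ne_zero.2 hab))).pow

/-- Two factorizations over a valuation ring that reduce to the base point are determined up to a
common scalar by their products and by the linear relations between them. -/
theorem exists_common_scalar [CharZero (ResidueField V)] {N α : ℕ} (hα : 1 ≤ α) (hαN : α ≤ N)
    {r s : ℕ → V} (hr : ∀ j, residue V (r j) ≠ 0) (hs : ∀ j, residue V (s j) ≠ 0)
    {κ : ResidueField V} (hκ : κ * (-2) ^ α = residue V (s 0)) {P₀ Q₀ P₁ Q₁ : V[X]}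
    (hQ₀N : Q₀.natDegree ≤ N) (hQ₁N : Q₁.natDegree ≤ N)
    (hP₀ : P₀.map (residue V) = 1) (hQ₀ : Q₀.map (residue V) = X ^ N)
    (hP₁ : P₁.map (residue V) = C (residue V (r 0)) * (X - C 1) ^ α)
    (hQ₁ : Q₁.map (residue V) = X ^ (N - α) * (C κ * (X - C 2) ^ α))
    (hP : P₁.coeff α = r 0 * P₀.coeff 0) {P₀' Q₀' P₁' Q₁' : K[X]}
    (hQ₀'N : Q₀'.natDegree ≤ N) (hP₁'N : P₁'.natDegree ≤ N) (hQ₁'N : Q₁'.natDegree ≤ N)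
    (h₀ : P₀' * Q₀' = (P₀ * Q₀).map (algebraMap V K))
    (h₁ : P₁' * Q₁' = (P₁ * Q₁).map (algebraMap V K))
    (hrel : ∀ j, j + α ≤ N → P₁'.coeff (j + α) = algebraMap V K (r j) * P₀'.coeff j)
    (hrel' : ∀ j, j + α ≤ N →
      Q₁'.coeff (N - (j + α)) = algebraMap V K (s j) * Q₀'.coeff (N - j)) :
    ∃ γ : K, P₀' = C γ * P₀.map (algebraMap V K) ∧ P₁' = C γ * P₁.map (algebraMap V K) := by
  have hinj : Function.Injective (algebraMap V K) := IsFractionRing.injective V K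
  have hκ0 : κ ≠ 0 := by
    rintro rfl
    exact hs 0 (by rw [← hκ, zero_mul])
  have hP₁0 : P₁.map (residue V) ≠ 0 := by
    rw [hP₁]
    exact mul_ne_zero (C_ne_zero.2 (hr 0)) (pow_ne_zero _ (X_sub_C_ne_zero _))
  have hκ2 : C κ * (X - C 2) ^ α ≠ 0 :=
    mul_ne_zero (C_ne_zero.2 hκ0) (pow_ne_zero _ (X_sub_C_ne_zero _))
  have hQ₁0 : Q₁.map (residue V) ≠ 0 := by
    rw [hQ₁]
    exact mul_ne_zero (pow_ne_zero _ X_ne_zero) hκ2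
  obtain ⟨c₀, p₀, q₀, hc₀, hp₀, hq₀, hpq₀⟩ := exists_factorization_of_map_eq_mul (f := P₀ * Q₀)
    (by rw [Polynomial.map_mul, hP₀, hQ₀, one_mul]; exact pow_ne_zero _ X_ne_zero) h₀
  obtain ⟨c₁, p₁, q₁, hc₁, hp₁, hq₁, hpq₁⟩ := exists_factorization_of_map_eq_mul (f := P₁ * Q₁)
    (by rw [Polynomial.map_mul]; exact mul_ne_zero hP₁0 hQ₁0) h₁
  have hp₁N : p₁.natDegree ≤ N := by
    rwa [hp₁, natDegree_C_mul hc₁, natDegree_map_eq_of_injective hinj] at hP₁'N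
  have hq₀N : q₀.natDegree ≤ N := by
    rwa [hq₀, natDegree_C_mul (inv_ne_zero hc₀), natDegree_map_eq_of_injective hinj] at hQ₀'N
  have hq₁N : q₁.natDegree ≤ N := by
    rwa [hq₁, natDegree_C_mul (inv_ne_zero hc₁), natDegree_map_eq_of_injective hinj] at hQ₁'N
  -- The ratio of the two Gauss scalars, in homogeneous coordinates with one entry 1, so that it
  -- survives reduction.
  obtain ⟨a, b, hab, habc⟩ : ∃ a b : V, (residue V a ≠ 0 ∨ residue V b ≠ 0) ∧
      algebraMap V K a * c₀ = algebraMap V K b * c₁ := by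
    rcases ValuationRing.isInteger_or_isInteger V (c₁ / c₀) with ⟨u, hu⟩ | ⟨u, hu⟩
    · refine ⟨u, 1, Or.inr (by simp), ?_⟩
      rw [hu, map_one]; field_simp
    · refine ⟨1, u, Or.inl (by simp), ?_⟩
      rw [hu, map_one]; field_simp
  have hres : ∀ j, j + α ≤ N → a * p₁.coeff (j + α) = b * (r j * p₀.coeff j) := by
    intro j hj
    apply hinj
    have h := hrel j hj
    rw [hp₁, hp₀, coeff_C_mul, coeff_C_mul, coeff_map, coeff_map] at h
    simp only [map_mul]
    apply mul_left_cancel₀ (mul_ne_zero hc₀ hc₁)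
    linear_combination c₀ * algebraMap V K a * h
      + algebraMap V K (r j) * c₀ * algebraMap V K (p₀.coeff j) * habc
  have hres' : ∀ j, j + α ≤ N →
      b * q₁.coeff (N - (j + α)) = a * (s j * q₀.coeff (N - j)) := by
    intro j hj
    apply hinj
    have h := hrel' j hj
    rw [hq₁, hq₀, coeff_C_mul, coeff_C_mul, coeff_map, coeff_map] at h
    simp only [map_mul]
    field_simp at h
    apply mul_left_cancel₀ (mul_ne_zero hc₀ hc₁)
    linear_combination c₁ * algebraMap V K b * h
      - algebraMap V K (s j) * c₁ * algebraMap V K (q₀.coeff (N - j)) * habc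
  obtain ⟨⟨e₀, he₀, hpe₀⟩, e₁, he₁, hpe₁⟩ := factors_eq_of_relations hα hαN hr hs hκ
    (p₀ := p₀.map (residue V)) (q₀ := q₀.map (residue V)) (p₁ := p₁.map (residue V))
    (q₁ := q₁.map (residue V)) (a := residue V a) (b := residue V b)
    (natDegree_map_le.trans hp₁N) (natDegree_map_le.trans hq₁N)
    (by rw [← Polynomial.map_mul, hpq₀, Polynomial.map_mul, hP₀, hQ₀, one_mul])
    (by rw [← Polynomial.map_mul, hpq₁, Polynomial.map_mul, hP₁, hQ₁]) hab
    (fun j hj => by simp only [coeff_map, ← map_mul, hres j hj])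
    (fun j hj => by simp only [coeff_map, ← map_mul, hres' j hj])
  obtain ⟨γ₀, hγ₀⟩ := exists_map_eq_C_mul_map_of_map_residue_eq (K := K) hpq₀ hQ₀N hq₀N
    (by rw [hQ₀, natDegree_X_pow]) (by rw [hQ₀]; exact pow_ne_zero _ X_ne_zero)
    (by rw [hP₀]; exact one_ne_zero) (by rw [hP₀]; exact isCoprime_one_left) he₀
    (by rw [hpe₀, hP₀, mul_one])
  obtain ⟨γ₁, hγ₁⟩ := exists_map_eq_C_mul_map_of_map_residue_eq (K := K) hpq₁ hQ₁N hq₁N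
    (by
      rw [hQ₁, natDegree_mul (pow_ne_zero _ X_ne_zero) hκ2, natDegree_X_pow,
        natDegree_C_mul hκ0, natDegree_pow, natDegree_X_sub_C]
      omega)
    hQ₁0 hP₁0
    (by
      rw [hP₁, hQ₁]
      refine (isCoprime_mul_unit_left_left (isUnit_C.2 (isUnit_iff_ne_zero.2 (hr 0))) _ _).2 ?_
      refine IsCoprime.mul_right ?_ ((isCoprime_mul_unit_left_right
        (isUnit_C.2 (isUnit_iff_ne_zero.2 hκ0)) _ _).2 (isCoprime_X_sub_C_pow (by norm_num) _ _))
      simpa using isCoprime_X_sub_C_pow (one_ne_zero (α := ResidueField V)) α (N - α))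
    (c := e₁ * (residue V (r 0))⁻¹) (mul_ne_zero he₁ (inv_ne_zero (hr 0)))
    (by
      rw [hpe₁, hP₁, ← mul_assoc, ← C_mul, mul_assoc, inv_mul_cancel₀ (hr 0), mul_one])
  have hP₀' : P₀' = C (c₀ * γ₀) * P₀.map (algebraMap V K) := by
    rw [hp₀, hγ₀, C_mul, mul_assoc]
  have hP₁' : P₁' = C (c₁ * γ₁) * P₁.map (algebraMap V K) := by
    rw [hp₁, hγ₁, C_mul, mul_assoc]
  -- The relation at j = 0 links the two scalars, since `P₀` has non-zero constant term.
  have hγ : c₀ * γ₀ = c₁ * γ₁ := by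
    have h := hrel 0 (by omega)
    rw [hP₀', hP₁', coeff_C_mul, coeff_C_mul, coeff_map, coeff_map, zero_add, hP, map_mul] at h
    have hr0 : algebraMap V K (r 0) ≠ 0 := by
      intro h0
      rw [map_eq_zero_iff _ hinj] at h0
      exact hr 0 (by rw [h0, map_zero])
    have hP0 : algebraMap V K (P₀.coeff 0) ≠ 0 := by
      intro h0
      rw [map_eq_zero_iff _ hinj] at h0
      have := congrArg (fun p => coeff p 0) hP₀
      simp [h0] at this
    apply mul_right_cancel₀ (mul_ne_zero hr0 hP0)
    linear_combination -h
  exact ⟨c₀ * γ₀, hP₀', hγ ▸ hP₁'⟩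

end ValuationRing

/-! ### Specialization along a valuation ring. -/

/-- If no element of `A` that survives under `ev` dies under `φ`, then `ev` is a specialization,
along a valuation ring, of a point of `R` with values in a field. -/
theorem exists_valuationSubring_specialization {A R F : Type} [CommRing A] [CommRing R] [Field F]
    (φ : A →+* R) (ev : A →+* F) (h : ∀ a, ev a ≠ 0 → φ a ≠ 0) :
    ∃ (K : Type) (_ : Field K) (V : ValuationSubring K) (ψ : R →+* K) (θ : A →+* V),
      (∀ a, algebraMap V K (θ a) = ψ (φ a)) ∧ ∀ a, ev a = 0 → residue V (θ a) = 0 := by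
  let S : Submonoid R := ((nonZeroDivisors F).comap ev).map φ
  have hS : Disjoint ((⊥ : Ideal R) : Set R) S := by
    rw [Set.disjoint_left]
    rintro x hx ⟨a, ha, rfl⟩
    exact h a (nonZeroDivisors.ne_zero ha) hx
  -- Modulo a prime avoiding S, whatever survives under `ev` becomes invertible in K, so A → K
  -- extends to the localization at the kernel of `ev`.
  obtain ⟨p, hp, -, hpS⟩ := Ideal.exists_le_prime_disjoint _ S hS
  let K := FractionRing (R ⧸ p)
  let ψ : R →+* K := (algebraMap (R ⧸ p) K).comp (Ideal.Quotient.mk p)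
  have hψ : ∀ a, ev a ≠ 0 → ψ (φ a) ≠ 0 := by
    intro a ha h0
    have h1 : Ideal.Quotient.mk p (φ a) = 0 :=
      (map_eq_zero_iff _ (IsFractionRing.injective (R ⧸ p) K)).1 h0
    rw [Ideal.Quotient.eq_zero_iff_mem] at h1
    exact Set.disjoint_left.1 hpS h1 ⟨a, mem_nonZeroDivisors_of_ne_zero ha, rfl⟩
  let q : Ideal A := RingHom.ker ev
  have : q.IsPrime := RingHom.ker_isPrime ev
  let f : Localization.AtPrime q →+* K := IsLocalization.lift (M := q.primeCompl)
    (g := ψ.comp φ) (fun a => isUnit_iff_ne_zero.2 (hψ a a.2))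
  have hf : ∀ a, f (algebraMap A _ a) = ψ (φ a) := fun a => IsLocalization.lift_eq _ a
  -- The map into V is local, so elements of the kernel of `ev` stay non-units.
  obtain ⟨V, hV, hloc⟩ := IsLocalRing.exists_factor_valuationRing f
  let g : Localization.AtPrime q →+* V := f.codRestrict V.toSubring hV
  refine ⟨K, inferInstance, V, ψ, g.comp (algebraMap A _), hf, ?_⟩
  intro a ha
  by_contra hne
  have hu : IsUnit (g (algebraMap A _ a)) := (residue_ne_zero_iff_isUnit _).1 hne
  have hu' := hloc.map_nonunit _ hu
  rw [IsLocalization.AtPrime.isUnit_to_map_iff _ q] at hu'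
  exact hu' ha

end PhaselessSTFT

namespace PhaselessSTFT

open Polynomial IsLocalRing ComplexConjugate

noncomputable section

/-! ### Coefficient polynomials and Fourier intensities. -/

/-- The polynomial with coefficient vector `y`. -/
def coeffPoly {S : Type*} [CommRing S] {W : ℕ} (y : Fin W → S) : S[X] :=
  ∑ n : Fin W, C (y n) * X ^ (n : ℕ)

section coeffPoly

variable {S T : Type*} [CommRing S] [CommRing T] {W : ℕ}

theorem coeff_coeffPoly (y : Fin W → S) {j : ℕ} (hj : j < W) :
    (coeffPoly y).coeff j = y ⟨j, hj⟩ := by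
  simp only [coeffPoly, finsetSum_coeff, coeff_C_mul, coeff_X_pow, mul_ite, mul_one, mul_zero]
  rw [Finset.sum_eq_single ⟨j, hj⟩]
  · simp
  · intro b _ hb
    rw [if_neg]
    rintro rfl
    exact hb rfl
  · simp

theorem coeff_coeffPoly_rev (y : Fin W → S) {j : ℕ} (hj : j < W) :
    (coeffPoly (y ∘ Fin.rev)).coeff (W - 1 - j) = y ⟨j, hj⟩ := by
  rw [coeff_coeffPoly _ (by omega), Function.comp_apply]
  congr 1
  ext
  simp only [Fin.val_rev]
  omega

theorem natDegree_coeffPoly_le (y : Fin W → S) : (coeffPoly y).natDegree ≤ W - 1 := by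
  refine natDegree_sum_le_of_forall_le _ _ fun n _ => ?_
  exact (natDegree_C_mul_X_pow_le _ _).trans (by omega)

theorem map_coeffPoly (f : S →+* T) (y : Fin W → S) :
    (coeffPoly y).map f = coeffPoly (fun n => f (y n)) := by
  simp [coeffPoly, Polynomial.map_sum]

theorem coeffPoly_coeff {p : S[X]} (hp : p.natDegree < W) :
    coeffPoly (fun n : Fin W => p.coeff n) = p := by
  rw [coeffPoly, Fin.sum_univ_eq_sum_range (fun n => C (p.coeff n) * X ^ n) W]
  exact (p.as_sum_range_C_mul_X_pow' hp).symm

theorem coeffPoly_coeff_rev {p : S[X]} (hp : p.natDegree < W) :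
    coeffPoly ((fun n : Fin W => p.coeff (W - 1 - n)) ∘ Fin.rev) = p := by
  rw [← coeffPoly_coeff hp]
  congr 1
  ext n
  simp only [Function.comp_apply, Fin.val_rev, coeffPoly_coeff hp]
  congr 1
  omega

end coeffPoly

section Fourier

variable {W : ℕ}

theorem eval_coeffPoly (y : Fin W → ℂ) (ω : Circle) :
    (coeffPoly y).eval (ω : ℂ) = fourier y ω := by
  simp [coeffPoly, fourier, eval_finsetSum]

theorem eval_coeffPoly_conj_rev (y : Fin W → ℂ) (ω : Circle) :
    (coeffPoly ((fun n => conj (y n)) ∘ Fin.rev)).eval (ω : ℂ)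
      = (ω : ℂ) ^ (W - 1) * conj (fourier y ω) := by
  rw [eval_coeffPoly, fourier, fourier, map_sum, Finset.mul_sum, ← Equiv.sum_comp Fin.revPerm]
  refine Finset.sum_congr rfl fun n _ => ?_
  simp only [Fin.revPerm_apply, Function.comp_apply, Fin.rev_rev, Fin.val_rev, map_mul, map_pow,
    ← Circle.coe_inv_eq_conj]
  have hω : (ω : ℂ) ≠ 0 := Circle.coe_ne_zero ω
  have h : (ω : ℂ) ^ (W - 1) = (ω : ℂ) ^ (W - (n + 1)) * (ω : ℂ) ^ (n : ℕ) := by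
    rw [← pow_add]
    congr 1
    omega
  rw [h, Circle.coe_inv, inv_pow]
  field_simp

theorem infinite_range_coe_circle : (Set.range (fun ω : Circle => (ω : ℂ))).Infinite := by
  have : Infinite (Set.Ioc (-Real.pi) Real.pi) :=
    (Set.Ioc_infinite (by linarith [Real.pi_pos])).to_subtype
  have : Infinite Circle := Circle.argEquiv.infinite_iff.2 this
  exact Set.infinite_range_of_injective Circle.coe_injective

/-- At ω on the circle both sides are ω^(W-1) times the intensity, and the circle is infinite. -/
theorem coeffPoly_mul_eq_of_fourierIntensity_eq {y y' : Fin W → ℂ}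
    (h : fourierIntensity y = fourierIntensity y') :
    coeffPoly y' * coeffPoly ((fun n => conj (y' n)) ∘ Fin.rev)
      = coeffPoly y * coeffPoly ((fun n => conj (y n)) ∘ Fin.rev) := by
  refine eq_of_infinite_eval_eq _ _ (infinite_range_coe_circle.mono ?_)
  rintro _ ⟨ω, rfl⟩
  have h1 : ‖fourier y ω‖ ^ 2 = ‖fourier y' ω‖ ^ 2 := congrFun h ω
  have h2 : fourier y ω * conj (fourier y ω) = fourier y' ω * conj (fourier y' ω) := by
    rw [Complex.mul_conj', Complex.mul_conj']
    exact_mod_cast h1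
  simp only [Set.mem_ofPred_eq, eval_mul, eval_coeffPoly_conj_rev]
  rw [eval_coeffPoly, eval_coeffPoly]
  linear_combination -(ω : ℂ) ^ (W - 1) * h2

theorem exists_fourier_ne_zero {y : Fin W → ℂ} {n : Fin W} (hn : y n ≠ 0) :
    ∃ ω, fourier y ω ≠ 0 := by
  by_contra! h
  have h0 : coeffPoly y = 0 := by
    refine eq_of_infinite_eval_eq _ _ (infinite_range_coe_circle.mono ?_)
    rintro _ ⟨ω, rfl⟩
    simp [eval_coeffPoly, h]
  have := coeff_coeffPoly y n.2
  rw [h0, coeff_zero] at this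
  exact hn this.symm

theorem eq_zero_of_fourierIntensity_eq {y y' : Fin W → ℂ} (hy : ∀ n, y n = 0)
    (h : fourierIntensity y = fourierIntensity y') (n : Fin W) : y' n = 0 := by
  by_contra hn
  obtain ⟨ω, hω⟩ := exists_fourier_ne_zero hn
  have h1 : ‖fourier y ω‖ ^ 2 = ‖fourier y' ω‖ ^ 2 := congrFun h ω
  have h2 : fourier y ω = 0 := by simp [fourier, hy]
  rw [h2, norm_zero] at h1
  exact hω (by simpa using h1.symm)

theorem norm_eq_one_of_fourierIntensity_eq {y y' : Fin W → ℂ} {n : Fin W} (hn : y n ≠ 0) {c : ℂ}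
    (hc : ∀ n, y' n = c * y n) (h : fourierIntensity y = fourierIntensity y') : ‖c‖ = 1 := by
  obtain ⟨ω, hω⟩ := exists_fourier_ne_zero hn
  have h1 : ‖fourier y ω‖ ^ 2 = ‖fourier y' ω‖ ^ 2 := congrFun h ω
  have h2 : fourier y' ω = c * fourier y ω := by
    simp only [fourier, hc, Finset.mul_sum, mul_assoc]
  rw [h2, norm_mul, mul_pow] at h1
  have h3 : ‖c‖ ^ 2 = 1 := by
    apply mul_right_cancel₀ (pow_ne_zero 2 (norm_ne_zero_iff.2 hω))
    rw [one_mul]; exact h1.symm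
  exact (pow_eq_one_iff_of_nonneg (norm_nonneg c) two_ne_zero).1 h3

/-- A pair proportional to `y` with the same Fourier intensities differs from `y` by a phase. -/
theorem exists_eq_exp_smul_of_minors_eq_zero {y y' : (Fin W → ℂ) × (Fin W → ℂ)}
    (h₀ : fourierIntensity y.1 = fourierIntensity y'.1)
    (h₁ : fourierIntensity y.2 = fourierIntensity y'.2)
    (h : ∀ i j, Sum.elim y.1 y.2 i * Sum.elim y'.1 y'.2 j
      - Sum.elim y.1 y.2 j * Sum.elim y'.1 y'.2 i = 0) :
    ∃ θ : ℝ, y' = Complex.exp (θ * Complex.I) • y := by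
  by_cases hy : ∀ i, Sum.elim y.1 y.2 i = 0
  · refine ⟨0, ?_⟩
    ext n
    · simpa [show y.1 n = 0 from hy (Sum.inl n)] using
        eq_zero_of_fourierIntensity_eq (fun n => hy (Sum.inl n)) h₀ n
    · simpa [show y.2 n = 0 from hy (Sum.inr n)] using
        eq_zero_of_fourierIntensity_eq (fun n => hy (Sum.inr n)) h₁ n
  · push Not at hy
    obtain ⟨i, hi⟩ := hy
    obtain ⟨c, hc⟩ : ∃ c, ∀ j, Sum.elim y'.1 y'.2 j = c * Sum.elim y.1 y.2 j := by
      refine ⟨Sum.elim y'.1 y'.2 i / Sum.elim y.1 y.2 i, fun j => ?_⟩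
      field_simp
      linear_combination h i j
    have hnorm : ‖c‖ = 1 := by
      rcases i with i | i
      · exact norm_eq_one_of_fourierIntensity_eq hi (fun n => hc (Sum.inl n)) h₀
      · exact norm_eq_one_of_fourierIntensity_eq hi (fun n => hc (Sum.inr n)) h₁
    refine ⟨c.arg, ?_⟩
    have hexp : Complex.exp (c.arg * Complex.I) = c := by
      conv_rhs => rw [← Complex.norm_mul_exp_arg_mul_I c, hnorm]
      simp
    rw [hexp]
    ext n
    · exact hc (Sum.inl n)
    · exact hc (Sum.inr n)

end Fourier

/-! ### Genericity tested on the complexification of Z. -/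

section Generic

variable {W : ℕ}

theorem exists_re_im_eval {σ : Type*} (F : MvPolynomial σ ℂ) :
    ∃ p q : MvPolynomial σ ℝ, ∀ x : σ → ℝ, MvPolynomial.eval (fun i => (x i : ℂ)) F
      = (MvPolynomial.eval x p : ℂ) + Complex.I * (MvPolynomial.eval x q : ℂ) := by
  induction F using MvPolynomial.induction_on with
  | C a =>
    refine ⟨MvPolynomial.C a.re, MvPolynomial.C a.im, fun x => ?_⟩
    simp only [MvPolynomial.eval_C]
    rw [mul_comm, Complex.re_add_im]
  | add F G hF hG =>
    obtain ⟨p, q, h⟩ := hF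
    obtain ⟨p', q', h'⟩ := hG
    refine ⟨p + p', q + q', fun x => ?_⟩
    simp only [map_add, h, h', Complex.ofReal_add]
    ring
  | mul_X F i hF =>
    obtain ⟨p, q, h⟩ := hF
    refine ⟨p * MvPolynomial.X i, q * MvPolynomial.X i, fun x => ?_⟩
    simp only [map_mul, MvPolynomial.eval_X, h, Complex.ofReal_mul]
    ring

/-- The complexified real coordinates of a pair whose entries are those of `u` and whose
conjugate entries, treated as independent variables, are those of the conjugate of `v`. -/
def complexCoords (u v : (Fin W → ℂ) × (Fin W → ℂ)) :
    (Fin W ⊕ Fin W) ⊕ (Fin W ⊕ Fin W) → ℂ :=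
  Sum.elim (fun i => (Sum.elim u.1 u.2 i + conj (Sum.elim v.1 v.2 i)) / 2)
    (fun i => (Sum.elim u.1 u.2 i - conj (Sum.elim v.1 v.2 i)) / (2 * Complex.I))

/-- With x = (u+v)/2 and y = (u-v)/(2i) in Z, the point (u, v) is the parameter t = i on the
complexified line x + ty. A polynomial in t that is non-zero at i is non-zero at some real t. -/
theorem exists_mem_eval_realCoords_ne_zero {Z : Submodule ℂ ((Fin W → ℂ) × (Fin W → ℂ))}
    {u v : (Fin W → ℂ) × (Fin W → ℂ)} (hu : u ∈ Z) (hv : v ∈ Z)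
    {F : MvPolynomial ((Fin W ⊕ Fin W) ⊕ (Fin W ⊕ Fin W)) ℂ}
    (hF : MvPolynomial.eval (complexCoords u v) F ≠ 0) :
    ∃ z ∈ Z, MvPolynomial.eval (fun i => (realCoords z i : ℂ)) F ≠ 0 := by
  set x : (Fin W → ℂ) × (Fin W → ℂ) := (1 / 2 : ℂ) • (u + v) with hx
  set y : (Fin W → ℂ) × (Fin W → ℂ) := (1 / (2 * Complex.I)) • (u - v) with hy
  have hxZ : x ∈ Z := Z.smul_mem _ (Z.add_mem hu hv)
  have hyZ : y ∈ Z := Z.smul_mem _ (Z.sub_mem hu hv)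
  let G : ℂ[X] := MvPolynomial.eval₂ C
    (fun i => C (realCoords x i : ℂ) + X * C (realCoords y i : ℂ)) F
  have hG : ∀ t : ℂ, G.eval t = MvPolynomial.eval
      (fun i => (realCoords x i : ℂ) + t * (realCoords y i : ℂ)) F := by
    intro t
    have h := MvPolynomial.hom_eval₂ F C (evalRingHom t)
      (fun i => C (realCoords x i : ℂ) + X * C (realCoords y i : ℂ))
    rw [coe_evalRingHom] at h
    have hC : (evalRingHom t).comp C = RingHom.id ℂ := by
      ext a
      simp
    rw [h, hC, MvPolynomial.eval₂_id]
    simp only [eval_add, eval_mul, eval_C, eval_X]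
  have hI : Complex.I ≠ 0 := Complex.I_ne_zero
  have hGI : G.eval Complex.I ≠ 0 := by
    have hxs : ∀ i, Sum.elim x.1 x.2 i = 1 / 2 * (Sum.elim u.1 u.2 i + Sum.elim v.1 v.2 i) := by
      rintro (i | i) <;> simp [hx, mul_add]
    have hys : ∀ i, Sum.elim y.1 y.2 i
        = 1 / (2 * Complex.I) * (Sum.elim u.1 u.2 i - Sum.elim v.1 v.2 i) := by
      rintro (i | i) <;> simp [hy]
    have hcoords : (fun i => (realCoords x i : ℂ) + Complex.I * (realCoords y i : ℂ))
        = complexCoords u v := by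
      funext i
      rcases i with i | i
      · simp only [realCoords, complexCoords, Sum.elim_inl, Complex.re_eq_add_conj]
        rw [hxs, hys]
        simp only [map_mul, map_sub, map_add, map_div₀, map_one, map_ofNat, Complex.conj_I]
        field_simp
        ring
      · simp only [realCoords, complexCoords, Sum.elim_inr, Complex.im_eq_sub_conj]
        rw [hxs, hys]
        simp only [map_mul, map_sub, map_add, map_div₀, map_one, map_ofNat, Complex.conj_I]
        field_simp
        ring
    rw [hG, hcoords]
    exact hF
  have hG0 : G ≠ 0 := by
    intro h0
    rw [h0] at hGI
    simp at hGI
  obtain ⟨t, ht⟩ : ∃ t : ℝ, G.eval (t : ℂ) ≠ 0 := by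
    by_contra! h
    refine hG0 (eq_zero_of_infinite_isRoot _
      ((Set.infinite_range_of_injective Complex.ofReal_injective).mono ?_))
    rintro _ ⟨t, rfl⟩
    exact h t
  refine ⟨x + (t : ℂ) • y, Z.add_mem hxZ (Z.smul_mem _ hyZ), ?_⟩
  rw [hG] at ht
  have hcoords : (fun i => (realCoords (x + (t : ℂ) • y) i : ℂ))
      = fun i => (realCoords x i : ℂ) + (t : ℂ) * (realCoords y i : ℂ) := by
    funext i
    rcases i with (i | i) | (i | i) <;> simp [realCoords]
  rwa [hcoords]

theorem genericOn_of_eval_ne_zero {Z : Submodule ℂ ((Fin W → ℂ) × (Fin W → ℂ))}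
    {P : (Fin W → ℂ) × (Fin W → ℂ) → Prop}
    {u v : (Fin W → ℂ) × (Fin W → ℂ)} (hu : u ∈ Z) (hv : v ∈ Z)
    {F : MvPolynomial ((Fin W ⊕ Fin W) ⊕ (Fin W ⊕ Fin W)) ℂ}
    (hF : MvPolynomial.eval (complexCoords u v) F ≠ 0)
    (hP : ∀ z ∈ Z, ¬ P z → MvPolynomial.eval (fun i => (realCoords z i : ℂ)) F = 0) :
    GenericOn Z P := by
  obtain ⟨z, hz, hFz⟩ := exists_mem_eval_realCoords_ne_zero hu hv hF
  obtain ⟨p, q, hpq⟩ := exists_re_im_eval F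
  -- At real points F = p + iq, so p² + q² has the same real zeros as F.
  refine ⟨p ^ 2 + q ^ 2, ⟨z, hz, fun h0 => hFz ?_⟩, fun z hz hne => ?_⟩
  · simp only [map_add, map_pow] at h0
    have h1 : MvPolynomial.eval (realCoords z) p = 0 := by nlinarith
    have h2 : MvPolynomial.eval (realCoords z) q = 0 := by nlinarith
    rw [hpq, h1, h2]
    simp
  · by_contra hPz
    have h0 := hP z hz hPz
    rw [hpq] at h0
    have h1 := congrArg Complex.re h0
    have h2 := congrArg Complex.im h0
    simp at h1 h2
    exact hne (by simp [h1, h2])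

/-- The entries of a pair, as polynomials in its real coordinates. -/
def entry (i : Fin W ⊕ Fin W) : MvPolynomial ((Fin W ⊕ Fin W) ⊕ (Fin W ⊕ Fin W)) ℂ :=
  MvPolynomial.X (Sum.inl i) + MvPolynomial.C Complex.I * MvPolynomial.X (Sum.inr i)

/-- The conjugates of the entries of a pair, as polynomials in its real coordinates. -/
def conjEntry (i : Fin W ⊕ Fin W) : MvPolynomial ((Fin W ⊕ Fin W) ⊕ (Fin W ⊕ Fin W)) ℂ :=
  MvPolynomial.X (Sum.inl i) - MvPolynomial.C Complex.I * MvPolynomial.X (Sum.inr i)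

theorem eval_realCoords_entry (z : (Fin W → ℂ) × (Fin W → ℂ)) (i : Fin W ⊕ Fin W) :
    MvPolynomial.eval (fun i => (realCoords z i : ℂ)) (entry i) = Sum.elim z.1 z.2 i := by
  simp only [entry, realCoords, map_add, map_mul, MvPolynomial.eval_X, MvPolynomial.eval_C,
    Sum.elim_inl, Sum.elim_inr]
  rw [mul_comm, Complex.re_add_im]

theorem eval_realCoords_conjEntry (z : (Fin W → ℂ) × (Fin W → ℂ)) (i : Fin W ⊕ Fin W) :
    MvPolynomial.eval (fun i => (realCoords z i : ℂ)) (conjEntry i)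
      = conj (Sum.elim z.1 z.2 i) := by
  simp only [conjEntry, realCoords, map_sub, map_mul, MvPolynomial.eval_X, MvPolynomial.eval_C,
    Sum.elim_inl, Sum.elim_inr]
  apply Complex.ext <;> simp

theorem eval_complexCoords_entry (u v : (Fin W → ℂ) × (Fin W → ℂ)) (i : Fin W ⊕ Fin W) :
    MvPolynomial.eval (complexCoords u v) (entry i) = Sum.elim u.1 u.2 i := by
  simp only [entry, complexCoords, map_add, map_mul, MvPolynomial.eval_X, MvPolynomial.eval_C,
    Sum.elim_inl, Sum.elim_inr]
  field_simp [Complex.I_ne_zero]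
  ring

theorem eval_complexCoords_conjEntry (u v : (Fin W → ℂ) × (Fin W → ℂ)) (i : Fin W ⊕ Fin W) :
    MvPolynomial.eval (complexCoords u v) (conjEntry i) = conj (Sum.elim v.1 v.2 i) := by
  simp only [conjEntry, complexCoords, map_sub, map_mul, MvPolynomial.eval_X, MvPolynomial.eval_C,
    Sum.elim_inl, Sum.elim_inr]
  field_simp [Complex.I_ne_zero]
  ring

end Generic

end

end PhaselessSTFT

namespace PhaselessSTFT

open Polynomial IsLocalRing ComplexConjugate

noncomputable section

/-! ### The base point, and rings of functions on the bad set. -/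

section Ratio

variable {W : ℕ}

/-- The ratio `w[j+α] / w[j]`, extended by `1`. -/
def windowRatio (α : ℕ) (w : Fin W → ℂ) (j : ℕ) : ℂ :=
  if h : j + α < W then w ⟨j + α, h⟩ / w ⟨j, by omega⟩ else 1

/-- The default value 1 makes this hold for every j, as `exists_common_scalar` requires. -/
theorem windowRatio_ne_zero {α : ℕ} {w : Fin W → ℂ} (hw : ∀ n, w n ≠ 0) (j : ℕ) :
    windowRatio α w j ≠ 0 := by
  unfold windowRatio
  split_ifs
  · exact div_ne_zero (hw _) (hw _)
  · exact one_ne_zero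

theorem mem_linearRelations_iff {α : ℕ} {w : Fin W → ℂ} (hw : ∀ n, w n ≠ 0)
    {y : (Fin W → ℂ) × (Fin W → ℂ)} :
    y ∈ linearRelations α w ↔ ∀ (j : ℕ) (h : j + α < W),
      y.2 ⟨j + α, h⟩ = windowRatio α w j * y.1 ⟨j, by omega⟩ := by
  refine forall₂_congr fun j h => ?_
  have h0 := hw ⟨j, by omega⟩
  rw [windowRatio, dif_pos h]
  field_simp
  exact eq_comm

end Ratio

/-- Polynomials `p` and `q` of degrees less than `W`, as a pair of coefficient vectors. -/
def coeffPair (W : ℕ) (p q : ℂ[X]) : (Fin W → ℂ) × (Fin W → ℂ) :=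
  (fun n => p.coeff n, fun n => q.coeff n)

/-- The pair of the conjugates of the reversed coefficient vectors of `p` and `q`. -/
def conjRevCoeffPair (W : ℕ) (p q : ℂ[X]) : (Fin W → ℂ) × (Fin W → ℂ) :=
  (fun n => conj (p.coeff (W - 1 - n)), fun n => conj (q.coeff (W - 1 - n)))

theorem coeffPair_mem_linearRelations {W α : ℕ} {w : Fin W → ℂ}
    (hw : ∀ n, w n ≠ 0) :
    coeffPair W 1 (C (windowRatio α w 0) * (X - C 1) ^ α) ∈ linearRelations α w := by
  rw [mem_linearRelations_iff hw]
  intro j h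
  have hm : ((X - C (1 : ℂ)) ^ α).Monic := (monic_X_sub_C 1).pow α
  have hdeg : ((X - C (1 : ℂ)) ^ α).natDegree = α := by
    rw [natDegree_pow, natDegree_X_sub_C, mul_one]
  simp only [coeffPair, coeff_C_mul, coeff_one]
  rcases Nat.eq_zero_or_pos j with rfl | hj
  · have := hm.coeff_natDegree
    rw [hdeg] at this
    rw [zero_add, this]
    simp
  · rw [coeff_eq_zero_of_natDegree_lt (by omega), if_neg (by omega)]
    simp

/-- Only j = 0 gives a non-trivial relation; it fixes the constant term κ(-2)^α of the factor beside
the power of X. -/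
theorem conjRevCoeffPair_mem_linearRelations {W α : ℕ} {w : Fin W → ℂ}
    (hw : ∀ n, w n ≠ 0) {κ : ℂ} (hκ : κ * (-2) ^ α = conj (windowRatio α w 0)) :
    conjRevCoeffPair W (X ^ (W - 1)) (X ^ (W - 1 - α) * (C κ * (X - C 2) ^ α))
      ∈ linearRelations α w := by
  rw [mem_linearRelations_iff hw]
  intro j h
  simp only [conjRevCoeffPair, coeff_X_pow, coeff_X_pow_mul']
  rcases Nat.eq_zero_or_pos j with rfl | hj
  · rw [if_pos (by omega), if_pos (by omega), show W - 1 - (0 + α) - (W - 1 - α) = 0 by omega,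
      coeff_zero_eq_eval_zero]
    simp [hκ]
  · rw [if_neg (by omega), if_neg (by omega)]
    simp

/-- If every minor of the pair of vectors `y, y'` vanishes on a point of a ring of functions with
values in a field, then it vanishes at some argument. -/
theorem exists_minors_eq_zero {B K ι : Type*} [Fintype ι] [Field K] (ψ : (B → ℂ) →+* K)
    {y y' : ι → B → ℂ} (h : ∀ i j, ψ (y i * y' j - y j * y' i) = 0) :
    ∃ b, ∀ i j, y i b * y' j b - y j b * y' i b = 0 := by
  by_contra! hne
  -- The sum of the squared moduli of the minors: if nowhere zero it would be invertible in the
  -- function ring, yet ψ kills it.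
  let δ : B → ℂ := ∑ i, ∑ j,
    (y i * y' j - y j * y' i) * (fun b => conj (y i b * y' j b - y j b * y' i b))
  have hδ : ψ δ = 0 := by
    simp only [δ, map_sum, map_mul, h, zero_mul, Finset.sum_const_zero]
  have hδb : ∀ b, δ b ≠ 0 := by
    intro b h0
    obtain ⟨i, j, hij⟩ := hne b
    have h1 : δ b = ((∑ i, ∑ j, Complex.normSq (y i b * y' j b - y j b * y' i b) : ℝ) : ℂ) := by
      simp only [δ, Finset.sum_apply, Pi.mul_apply, Pi.sub_apply, Complex.mul_conj,
        Complex.ofReal_sum]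
    rw [h1, Complex.ofReal_eq_zero, Finset.sum_eq_zero_iff_of_nonneg
      (fun i _ => Finset.sum_nonneg fun j _ => Complex.normSq_nonneg _)] at h0
    have h2 := h0 i (Finset.mem_univ i)
    rw [Finset.sum_eq_zero_iff_of_nonneg (fun j _ => Complex.normSq_nonneg _)] at h2
    exact hij (Complex.normSq_eq_zero.1 (h2 j (Finset.mem_univ j)))
  have h1 : δ * (fun b => (δ b)⁻¹) = 1 := by
    funext b
    exact mul_inv_cancel₀ (hδb b)
  have h2 := congrArg ψ h1
  rw [map_mul, hδ, zero_mul, map_one] at h2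
  exact zero_ne_one h2

theorem coeffPoly_mul_eq_of_forall {B : Type*} {W : ℕ} {y y' z z' : Fin W → B → ℂ}
    (h : ∀ b, coeffPoly (fun n => y n b) * coeffPoly (fun n => y' n b)
      = coeffPoly (fun n => z n b) * coeffPoly (fun n => z' n b)) :
    coeffPoly y * coeffPoly y' = coeffPoly z * coeffPoly z' := by
  ext m : 1
  funext b
  have h1 := congrArg (fun p => p.coeff m) (h b)
  have hmap : ∀ u v : Fin W → B → ℂ, (coeffPoly u * coeffPoly v).coeff m b
      = (coeffPoly (fun n => u n b) * coeffPoly (fun n => v n b)).coeff m := by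
    intro u v
    have h2 : (coeffPoly u * coeffPoly v).map (Pi.evalRingHom (fun _ => ℂ) b)
        = coeffPoly (fun n => u n b) * coeffPoly (fun n => v n b) := by
      rw [Polynomial.map_mul, map_coeffPoly, map_coeffPoly]
      rfl
    rw [← h2, coeff_map]
    rfl
  rw [hmap, hmap]
  exact h1

end

end PhaselessSTFT

/-! ### The main argument. -/

open Polynomial IsLocalRing ComplexConjugate PhaselessSTFT in
theorem mainTheorem3 (W α : ℕ) (hα : 1 ≤ α) (hαW : α < W)
    (w : Fin W → ℂ) (hw : ∀ n, w n ≠ 0) :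
    PhaselessSTFT.GenericOn (PhaselessSTFT.linearRelations α w) (fun y =>
      ∀ y' ∈ PhaselessSTFT.linearRelations α w,
        PhaselessSTFT.fourierIntensity y.1 = PhaselessSTFT.fourierIntensity y'.1 →
        PhaselessSTFT.fourierIntensity y.2 = PhaselessSTFT.fourierIntensity y'.2 →
        ∃ θ : ℝ, y' = Complex.exp (θ * Complex.I) • y) := by
  set Z := linearRelations α w with hZ
  set P : (Fin W → ℂ) × (Fin W → ℂ) → Prop := fun y => ∀ y' ∈ Z,
    fourierIntensity y.1 = fourierIntensity y'.1 → fourierIntensity y.2 = fourierIntensity y'.2 →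
    ∃ θ : ℝ, y' = Complex.exp (θ * Complex.I) • y with hPdef
  by_contra hgen
  let κ : ℂ := conj (windowRatio α w 0) / (-2) ^ α
  have h2 : (-2 : ℂ) ^ α ≠ 0 := pow_ne_zero _ (by norm_num)
  have hκ : κ * (-2) ^ α = conj (windowRatio α w 0) := div_mul_cancel₀ _ h2
  have hr := windowRatio_ne_zero (α := α) hw
  have hκ0 : κ ≠ 0 := div_ne_zero ((_root_.map_ne_zero _).2 (hr 0)) h2
  set p₁ : ℂ[X] := C (windowRatio α w 0) * (X - C 1) ^ α with hp₁
  set q₁ : ℂ[X] := X ^ (W - 1 - α) * (C κ * (X - C 2) ^ α) with hq₁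
  have hp₁W : p₁.natDegree < W := by
    rw [hp₁, natDegree_C_mul (hr 0), natDegree_pow, natDegree_X_sub_C]
    omega
  have hq₁W : q₁.natDegree < W := by
    rw [hq₁, natDegree_mul (pow_ne_zero _ X_ne_zero)
      (mul_ne_zero (C_ne_zero.2 hκ0) (pow_ne_zero _ (X_sub_C_ne_zero _))), natDegree_X_pow,
      natDegree_C_mul hκ0, natDegree_pow, natDegree_X_sub_C]
    omega
  let u := coeffPair W 1 p₁
  let v := conjRevCoeffPair W (X ^ (W - 1)) q₁
  have hu : u ∈ Z := coeffPair_mem_linearRelations hw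
  have hv : v ∈ Z := conjRevCoeffPair_mem_linearRelations hw hκ
  let B := {z // z ∈ Z ∧ ¬ P z}
  let φ : MvPolynomial ((Fin W ⊕ Fin W) ⊕ (Fin W ⊕ Fin W)) ℂ →+* (B → ℂ) :=
    RingHom.pi fun b => MvPolynomial.eval (fun i => (realCoords b.1 i : ℂ))
  have hφ : ∀ F (b : B), φ F b = MvPolynomial.eval (fun i => (realCoords b.1 i : ℂ)) F :=
    fun F b => rfl
  obtain ⟨K, hK, V, ψ, θ, hθ, hres⟩ := exists_valuationSubring_specialization φ
    (MvPolynomial.eval (complexCoords u v)) (by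
      intro F hF hφF
      refine hgen (genericOn_of_eval_ne_zero hu hv hF fun z hz hPz => ?_)
      rw [← hφ F ⟨z, hz, hPz⟩, hφF]
      rfl)
  let ι : ℂ →+* ResidueField V := (residue V).comp (θ.comp MvPolynomial.C)
  -- F minus its value at the base point vanishes there, so it reduces to zero.
  have hι : ∀ F, residue V (θ F) = ι (MvPolynomial.eval (complexCoords u v) F) := by
    intro F
    have h0 := hres (F - MvPolynomial.C (MvPolynomial.eval (complexCoords u v) F)) (by simp)
    rw [map_sub, map_sub, sub_eq_zero] at h0
    exact h0
  have hchar : CharZero (ResidueField V) := charZero_of_injective_ringHom ι.injective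
  have hbad : ∀ b : B, ∃ y' ∈ Z, fourierIntensity b.1.1 = fourierIntensity y'.1 ∧
      fourierIntensity b.1.2 = fourierIntensity y'.2 ∧
      ¬ ∃ θ : ℝ, y' = Complex.exp (θ * Complex.I) • b.1 := by
    intro b
    have := b.2.2
    simp only [hPdef] at this
    push Not at this
    simpa using this
  choose y' hy'Z hy'₀ hy'₁ hy' using hbad
  let x : Fin W ⊕ Fin W → B → ℂ := fun i b => Sum.elim (y' b).1 (y' b).2 i
  -- Conjugates get their own family, because ψ carries no compatibility with conjugation.
  let x' : Fin W ⊕ Fin W → B → ℂ := fun i b => conj (Sum.elim (y' b).1 (y' b).2 i)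
  have hentry : ∀ i b, φ (entry i) b = Sum.elim b.1.1 b.1.2 i :=
    fun i b => eval_realCoords_entry b.1 i
  have hconj : ∀ i b, φ (conjEntry i) b = conj (Sum.elim b.1.1 b.1.2 i) :=
    fun i b => eval_realCoords_conjEntry b.1 i
  have hprod : ∀ f : Fin W → Fin W ⊕ Fin W,
      (∀ b, fourierIntensity (fun n => Sum.elim b.1.1 b.1.2 (f n))
        = fourierIntensity (fun n => Sum.elim (y' b).1 (y' b).2 (f n))) →
      coeffPoly (fun n => ψ (x (f n))) * coeffPoly ((fun n => ψ (x' (f n))) ∘ Fin.rev)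
        = (coeffPoly (fun n => θ (entry (f n))) *
          coeffPoly ((fun n => θ (conjEntry (f n))) ∘ Fin.rev)).map (algebraMap V K) := by
    intro f hf
    have h := coeffPoly_mul_eq_of_forall (y := fun n => x (f n))
      (y' := (fun n => x' (f n)) ∘ Fin.rev)
      (z := fun n => φ (entry (f n))) (z' := (fun n => φ (conjEntry (f n))) ∘ Fin.rev)
      (fun b => by
        simp only [Function.comp_def, hentry, hconj]
        exact coeffPoly_mul_eq_of_fourierIntensity_eq (hf b))
    have h1 := congrArg (Polynomial.map ψ) h
    simp only [Polynomial.map_mul, map_coeffPoly, Function.comp_def] at h1 ⊢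
    simp only [hθ]
    exact h1
  have hrelx : ∀ j (h : j + α < W), x (Sum.inr ⟨j + α, h⟩)
      = φ (MvPolynomial.C (windowRatio α w j)) * x (Sum.inl ⟨j, by omega⟩) := by
    intro j h
    funext b
    rw [Pi.mul_apply, hφ, MvPolynomial.eval_C]
    exact (mem_linearRelations_iff hw).1 (hy'Z b) j h
  have hrelx' : ∀ j (h : j + α < W), x' (Sum.inr ⟨j + α, h⟩)
      = φ (MvPolynomial.C (conj (windowRatio α w j))) * x' (Sum.inl ⟨j, by omega⟩) := by
    intro j h
    funext b
    rw [Pi.mul_apply, hφ, MvPolynomial.eval_C, ← map_mul]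
    exact congrArg conj ((mem_linearRelations_iff hw).1 (hy'Z b) j h)
  have hrele : φ (entry (Sum.inr ⟨α, hαW⟩))
      = φ (MvPolynomial.C (windowRatio α w 0)) * φ (entry (Sum.inl ⟨0, by omega⟩)) := by
    funext b
    rw [Pi.mul_apply, hentry, hentry, hφ, MvPolynomial.eval_C]
    have := (mem_linearRelations_iff hw).1 b.2.1 0 (by omega)
    simpa using this
  obtain ⟨γ, hγ₀, hγ₁⟩ := exists_common_scalar (K := K) (N := W - 1) hα (by omega)
    (r := fun j => θ (MvPolynomial.C (windowRatio α w j)))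
    (s := fun j => θ (MvPolynomial.C (conj (windowRatio α w j)))) (κ := ι κ)
    (fun j => (_root_.map_ne_zero ι).2 (hr j))
    (fun j => (_root_.map_ne_zero ι).2 ((_root_.map_ne_zero _).2 (hr j)))
    (by
      have h := congrArg ι hκ
      rw [map_mul, map_pow, map_neg, map_ofNat] at h
      exact h)
    (natDegree_coeffPoly_le ((fun n => θ (conjEntry (Sum.inl n))) ∘ Fin.rev))
    (natDegree_coeffPoly_le ((fun n => θ (conjEntry (Sum.inr n))) ∘ Fin.rev))
    (P₀ := coeffPoly fun n => θ (entry (Sum.inl n)))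
    (P₁ := coeffPoly fun n => θ (entry (Sum.inr n)))
    (by
      rw [map_coeffPoly]
      simp only [hι, eval_complexCoords_entry]
      rw [← map_coeffPoly ι]
      have h := coeffPoly_coeff (W := W) (p := (1 : ℂ[X])) (by rw [natDegree_one]; omega)
      exact (congrArg (Polynomial.map ι) h).trans (Polynomial.map_one ι))
    (by
      rw [map_coeffPoly]
      simp only [Function.comp_apply, hι, eval_complexCoords_conjEntry]
      rw [← map_coeffPoly ι]
      have h := coeffPoly_coeff_rev (W := W) (p := (X ^ (W - 1) : ℂ[X]))
        (by rw [natDegree_X_pow]; omega)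
      have h1 := congrArg (Polynomial.map ι) h
      rw [Polynomial.map_pow, map_X] at h1
      rw [← h1]
      congr 2
      funext n
      exact Complex.conj_conj _)
    (by
      rw [map_coeffPoly]
      simp only [hι, eval_complexCoords_entry]
      rw [← map_coeffPoly ι]
      have h1 := congrArg (Polynomial.map ι) (coeffPoly_coeff hp₁W)
      refine h1.trans ?_
      simp [hp₁, Polynomial.map_mul])
    (by
      rw [map_coeffPoly]
      simp only [Function.comp_apply, hι, eval_complexCoords_conjEntry]
      rw [← map_coeffPoly ι]
      have h1 := congrArg (Polynomial.map ι) (coeffPoly_coeff_rev hq₁W)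
      refine Eq.trans ?_ (h1.trans ?_)
      · congr 2
        funext n
        exact Complex.conj_conj _
      · rw [hq₁, Polynomial.map_mul, Polynomial.map_mul, Polynomial.map_pow, Polynomial.map_pow,
          Polynomial.map_sub, map_X, map_C, map_C, map_ofNat])
    (by
      rw [coeff_coeffPoly _ hαW, coeff_coeffPoly _ (by omega)]
      apply IsFractionRing.injective V K
      rw [map_mul, hθ, hθ, hθ, hrele, map_mul])
    (P₀' := coeffPoly fun n => ψ (x (Sum.inl n)))
    (P₁' := coeffPoly fun n => ψ (x (Sum.inr n)))
    (natDegree_coeffPoly_le ((fun n => ψ (x' (Sum.inl n))) ∘ Fin.rev))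
    (natDegree_coeffPoly_le _)
    (natDegree_coeffPoly_le ((fun n => ψ (x' (Sum.inr n))) ∘ Fin.rev))
    (hprod Sum.inl hy'₀) (hprod Sum.inr hy'₁)
    (by
      intro j hj
      rw [coeff_coeffPoly _ (by omega : j + α < W), coeff_coeffPoly _ (by omega : j < W), hrelx,
        map_mul, hθ])
    (by
      intro j hj
      rw [coeff_coeffPoly_rev _ (by omega : j + α < W), coeff_coeffPoly_rev _ (by omega : j < W),
        hrelx', map_mul, hθ])
  have hγ : ∀ i, ψ (x i) = γ * ψ (φ (entry i)) := by
    rintro (n | n)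
    · have h := congrArg (fun p => p.coeff n) hγ₀
      simp only [coeff_C_mul, coeff_map, coeff_coeffPoly _ n.2, hθ] at h
      exact h
    · have h := congrArg (fun p => p.coeff n) hγ₁
      simp only [coeff_C_mul, coeff_map, coeff_coeffPoly _ n.2, hθ] at h
      exact h
  obtain ⟨b, hb⟩ := exists_minors_eq_zero ψ (y := fun i => φ (entry i)) (y' := x) (by
    intro i j
    simp only [map_sub, map_mul, hγ]
    ring)
  simp only [hentry] at hb
  exact hy' b (exists_eq_exp_smul_of_minors_eq_zero (hy'₀ b) (hy'₁ b) hb)
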